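/- For $n\ge 3$ let $D_n=\langle r,z\mid r^n=z^2=(zr)^2=1\rangle$ be the dihedral group of order $2n$, and let $X_n$ be the Cayley graph of $S_3\times D_n$ with respect to the involutions $a=((1\,2),1)$, $b=((1\,3),z)$, $c=((2\,3),zr)$; that is, its vertices are the elements $g$ of $S_3\times D_n$ and its edges are the pairs $\{g,gs\}$ with $s\in\{a,b,c\}$. A $d$-rainbow dominating function on a finite graph $G=(V,E)$ is a map $f\colon V\to 2^{\{1,\dots,d\}}$ such that for every vertex $v$ with $f(v)=\emptyset$ the sets $f(u)$, over the neighbours $u$ of $v$, have union $\{1,\dots,d\}$; its weight is $\sum_{v\in V}|f(v)|$, and $\gamma_{rd}(G)$ is the minimum weight of such a function. A $d$-regular graph $G$ is $d$-RDR ($d$-rainbow domination regular) if $\gamma_{rd}(G)=|V|/2$. For integers $1\le k\le n/2$ the generalized Petersen graph $\mathrm{GP}(n,k)$ has vertices $u_i,v_i$ ($i\in\mathbb Z_n$) and edges $\{u_i,u_{i+1}\}$, $\{u_i,v_i\}$, $\{v_i,v_{i+k}\}$. For integers $m\ge 1$, $n\ge 4$ even, and $0\le\ell\le n/2$ with $\ell\equiv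 m\pmod 2$, the honeycomb toroidal graph $\mathrm{HTG}(m,n,\ell)$ has vertices $v_{i,j}$ ($i\in\mathbb Z_m$, $j\in\mathbb Z_n$) and edges $\{v_{i,j},v_{i,j+1}\}$ for all $i,j$; $\{v_{i,j},v_{i+1,j}\}$ for $0\le i\le m-2$ and $j\equiv i+1\pmod 2$; and $\{v_{m-1,j},v_{0,j+\ell}\}$ for $j\equiv m\pmod 2$. Then for every $m\ge 1$ the graph $X_{3m}$ has order $36m$, is vertex-transitive and is $3$-RDR, and it is not isomorphic to any honeycomb toroidal graph $\mathrm{HTG}(m',n,\ell)$ nor to any generalized Petersen graph $\mathrm{GP}(n,k)$. Moreover the graphs $X_{3m}$, $m\ge 1$, are pairwise non-isomorphic, so they form an infinite family. -/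

import Mathlib

/-- A `k`-rainbow dominating function on `G`, with the colours `Fin k`: a vertex that carries no
colour sees every colour among its neighbours. -/
def IsRainbowDominating {V : Type*} (G : SimpleGraph V) (k : ℕ) (f : V → Finset (Fin k)) : Prop :=
  ∀ v, f v = ∅ → ∀ c : Fin k, ∃ u, G.Adj v u ∧ c ∈ f u

/-- The weight `∑ v, |f v|`. -/
def rainbowWeight {V : Type*} [Fintype V] {k : ℕ} (f : V → Finset (Fin k)) : ℕ :=
  ∑ v, (f v).card

/-- The `k`-rainbow domination number: the minimum weight of a `k`-rainbow dominating function.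
The set of weights is never empty, see `exists_rainbowWeight`, so this infimum is a minimum. -/
noncomputable def rainbowDominationNumber {V : Type*} [Fintype V] (G : SimpleGraph V) (k : ℕ) : ℕ :=
  sInf {w : ℕ | ∃ f : V → Finset (Fin k), IsRainbowDominating G k f ∧ rainbowWeight f = w}

theorem exists_rainbowWeight {V : Type*} [Fintype V] (G : SimpleGraph V) (k : ℕ) :
    {w : ℕ | ∃ f : V → Finset (Fin k), IsRainbowDominating G k f ∧ rainbowWeight f = w}.Nonempty :=
  ⟨_, fun _ => Finset.univ, fun _ hv c =>
    absurd (Finset.mem_univ c) (by rw [show (Finset.univ : Finset (Fin k)) = ∅ from hv]; simp), rfl⟩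

/-- A finite `d`-regular graph on `n` vertices whose `d`-rainbow domination number is `n / 2`. -/
def IsRainbowDominationRegular {V : Type*} (G : SimpleGraph V) (d : ℕ) : Prop :=
  ∃ (_ : Fintype V) (_ : G.LocallyFinite),
    G.IsRegularOfDegree d ∧ 2 * rainbowDominationNumber G d = Fintype.card V

/-- The automorphism group acts transitively on the vertices. -/
def IsVertexTransitive {V : Type*} (G : SimpleGraph V) : Prop :=
  ∀ u v : V, ∃ φ : G ≃g G, φ u = v

/-- The graph `X_n`: the Cayley graph of `S₃ × Dₙ` with respect to the three involutions
`a = ((1 2), 1)`, `b = ((1 3), z)` and `c = ((2 3), z r)`, where `r` is the rotation and `z` the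
reflection of the dihedral group `Dₙ` of order `2 n`, and the points `1, 2, 3` are the elements
`0, 1, 2` of `Fin 3`. -/
def graphX (n : ℕ) : SimpleGraph (Equiv.Perm (Fin 3) × DihedralGroup n) :=
  SimpleGraph.mulCayley
    {(Equiv.swap 0 1, 1),
     (Equiv.swap 0 2, DihedralGroup.sr 0),
     (Equiv.swap 1 2, DihedralGroup.sr 0 * DihedralGroup.r 1)}

/-- The generalized Petersen graph `GP(n, k)`, where `1 ≤ k ≤ n / 2`; `inl i` is the outer vertex
`u_i` and `inr i` is the inner vertex `v_i`. -/
def generalizedPetersen (n k : ℕ) : SimpleGraph (ZMod n ⊕ ZMod n) :=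
  SimpleGraph.fromRel fun x y =>
    (∃ i : ZMod n, x = Sum.inl i ∧ y = Sum.inl (i + 1)) ∨
    (∃ i : ZMod n, x = Sum.inl i ∧ y = Sum.inr i) ∨
    (∃ i : ZMod n, x = Sum.inr i ∧ y = Sum.inr (i + (k : ZMod n)))

/-- The honeycomb toroidal graph `HTG(m, n, ℓ)`, where `m ≥ 1`, `n ≥ 4` is even, `0 ≤ ℓ ≤ n / 2`
and `ℓ ≡ m (mod 2)`; the pair `(i, j)` is the vertex `v_{i,j}`. The three alternatives are the
vertical edges, the horizontal edges and the jumps. -/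
def honeycombToroidal (m n l : ℕ) : SimpleGraph (ZMod m × ZMod n) :=
  SimpleGraph.fromRel fun x y =>
    (∃ (i : ZMod m) (j : ZMod n), x = (i, j) ∧ y = (i, j + 1)) ∨
    (∃ (i : ZMod m) (j : ZMod n), i.val + 1 < m ∧ i.val + 1 ≡ j.val [MOD 2] ∧
      x = (i, j) ∧ y = (i + 1, j)) ∨
    (∃ (i : ZMod m) (j : ZMod n), i.val + 1 = m ∧ j.val ≡ m [MOD 2] ∧
      x = (i, j) ∧ y = (0, j + (l : ZMod n)))

/-! Double counting bounds the weight below by half the order (`card_le_two_mul_rainbowWeight`), and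
colouring each odd permutation by its fixed point attains the bound.

The non-isomorphisms rest on short non-backtracking closed walks. A short word has small rotation,
so if it is trivial in `S₃ × Dₙ` with `n` above that rotation, it is already trivial in `S₃ × D_∞`.
The relevant hexagons and octagons are thus found by one finite computation, uniform in `n`.

An `a`-edge lies on no hexagon (`not_genX_zero_of_hexagon`), whereas a honeycomb toroidal graph has
a vertex whose three edges all lie on hexagons, or one with at most two neighbours. Octagons supply
a property invariant under isomorphism that singles out the `a`-edges (`IsOctagonRich`). Rotations
of `GP(n, k)` then keep `a`-edges off the outer cycle, so it alternates `b` and `c` and returns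
after `6m` steps, while comparing orders gives it length `n = 18m`. Order alone separates the
members of the family. -/

/-- The three generators `a`, `b`, `c` of the Cayley graph `graphX n`. -/
def genX (n : ℕ) : Fin 3 → Equiv.Perm (Fin 3) × DihedralGroup n :=
  ![(Equiv.swap 0 1, 1), (Equiv.swap 0 2, DihedralGroup.sr 0),
    (Equiv.swap 1 2, DihedralGroup.sr 0 * DihedralGroup.r 1)]

theorem genX_mul_self (n : ℕ) (s : Fin 3) : genX n s * genX n s = 1 := by
  fin_cases s <;> simp [genX, Prod.ext_iff]

theorem genX_injective (n : ℕ) : Function.Injective (genX n) := by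
  have key : Function.Injective
      (![Equiv.swap 0 1, Equiv.swap 0 2, Equiv.swap 1 2] : Fin 3 → Equiv.Perm (Fin 3)) := by
    decide
  intro s t h
  apply key
  have h1 := congrArg Prod.fst h
  fin_cases s <;> fin_cases t <;> exact h1

theorem genX_ne_one (n : ℕ) (s : Fin 3) : genX n s ≠ 1 := by
  have key : ∀ s : Fin 3, (![Equiv.swap 0 1, Equiv.swap 0 2, Equiv.swap 1 2] :
      Fin 3 → Equiv.Perm (Fin 3)) s ≠ 1 := by decide
  intro h
  apply key s
  have h1 := congrArg Prod.fst h
  fin_cases s <;> exact h1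

theorem graphX_adj {n : ℕ} {u v : Equiv.Perm (Fin 3) × DihedralGroup n} :
    (graphX n).Adj u v ↔ ∃ s, v = u * genX n s := by
  rw [graphX, SimpleGraph.mulCayley_adj']
  constructor
  · rintro ⟨-, g, hg, h⟩
    have hs : ∃ s, g = genX n s := by
      rcases hg with rfl | rfl | rfl
      exacts [⟨0, rfl⟩, ⟨1, rfl⟩, ⟨2, rfl⟩]
    obtain ⟨s, rfl⟩ := hs
    refine ⟨s, ?_⟩
    rcases h with h | h
    · exact h.symm
    · rw [h, mul_assoc, genX_mul_self, mul_one]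
  · rintro ⟨s, rfl⟩
    refine ⟨fun h => genX_ne_one n s (by simpa using h.symm), genX n s, ?_, Or.inl rfl⟩
    fin_cases s <;> simp [genX]

theorem graphX_adj_mul {n : ℕ} (u : Equiv.Perm (Fin 3) × DihedralGroup n) (s : Fin 3) :
    (graphX n).Adj u (u * genX n s) :=
  graphX_adj.2 ⟨s, rfl⟩

theorem mul_genX_inj {n : ℕ} {u : Equiv.Perm (Fin 3) × DihedralGroup n} {s t : Fin 3} :
    u * genX n s = u * genX n t ↔ s = t :=
  ⟨fun h => genX_injective n (mul_left_cancel h), fun h => h ▸ rfl⟩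

theorem isVertexTransitive_graphX (n : ℕ) : IsVertexTransitive (graphX n) := fun u v =>
  ⟨{ toEquiv := Equiv.mulLeft (v * u⁻¹)
     map_rel_iff' := by
      intro x y
      simp only [graphX_adj, Equiv.coe_mulLeft, mul_assoc, mul_right_inj] },
    by simp⟩

theorem natCard_graphX (n : ℕ) :
    Nat.card (Equiv.Perm (Fin 3) × DihedralGroup n) = 12 * n := by
  rw [Nat.card_prod, DihedralGroup.nat_card, Nat.card_perm, Nat.card_fin]
  simp only [Nat.factorial]
  ring

/-! ### Rainbow domination -/

/-- A regular graph of degree `d ≥ 1` has `d`-rainbow domination number at least half its order. -/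
theorem card_le_two_mul_rainbowWeight {V : Type*} [Fintype V] {G : SimpleGraph V}
    [G.LocallyFinite] {d : ℕ} (hd : 0 < d) (hG : G.IsRegularOfDegree d) {f : V → Finset (Fin d)}
    (hf : IsRainbowDominating G d f) : Fintype.card V ≤ 2 * rainbowWeight f := by
  classical
  have hvert : ∀ v, d ≤ d * (f v).card + ∑ u ∈ G.neighborFinset v, (f u).card := by
    intro v
    rcases (f v).eq_empty_or_nonempty with hv | hv
    · have : (Finset.univ : Finset (Fin d)) ⊆ (G.neighborFinset v).biUnion f := by
        intro c _
        obtain ⟨u, hu, hc⟩ := hf v hv c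
        exact Finset.mem_biUnion.2 ⟨u, by simpa using hu, hc⟩
      have h1 := (Finset.card_le_card this).trans Finset.card_biUnion_le
      rw [Finset.card_univ, Fintype.card_fin] at h1
      omega
    · have : 1 ≤ (f v).card := hv.card_pos
      exact (Nat.le_mul_of_pos_right d this).trans (Nat.le_add_right _ _)
  -- Each `u` is counted once for each of its `d` neighbours.
  have hswap : ∑ v, ∑ u ∈ G.neighborFinset v, (f u).card = d * rainbowWeight f := by
    rw [Finset.sum_comm' (t' := Finset.univ) (s' := fun u => G.neighborFinset u)
      (by intro x y; simp [G.adj_comm])]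
    simp only [Finset.sum_const, SimpleGraph.card_neighborFinset_eq_degree, hG.degree_eq,
      smul_eq_mul, rainbowWeight, Finset.mul_sum]
  have hsum := Finset.sum_le_sum fun v (_ : v ∈ Finset.univ) => hvert v
  rw [Finset.sum_add_distrib, hswap, ← Finset.mul_sum, Finset.sum_const, smul_eq_mul,
    Finset.card_univ] at hsum
  change _ ≤ d * rainbowWeight f + _ at hsum
  nlinarith

/-- The colouring of the odd permutations of three points by three colours. -/
def oddPermColour (σ : Equiv.Perm (Fin 3)) : Finset (Fin 3) :=
  if Equiv.Perm.sign σ = -1 then Finset.univ.filter fun i => σ i = i else ∅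

theorem sum_card_oddPermColour : ∑ σ, (oddPermColour σ).card = 3 := by
  decide

/-- An uncoloured permutation is even. Multiplied by the three transpositions it yields all three
odd permutations, whose fixed points are distinct. -/
theorem exists_mem_oddPermColour (σ : Equiv.Perm (Fin 3)) (h : oddPermColour σ = ∅)
    (c : Fin 3) : ∃ s : Fin 3, c ∈ oddPermColour
      (σ * ![Equiv.swap 0 1, Equiv.swap 0 2, Equiv.swap 1 2] s) := by
  revert σ c
  decide

theorem fst_genX (n : ℕ) (s : Fin 3) : (genX n s).1 =
    (![Equiv.swap 0 1, Equiv.swap 0 2, Equiv.swap 1 2] : Fin 3 → Equiv.Perm (Fin 3)) s := by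
  fin_cases s <;> rfl

theorem isRainbowDominationRegular_graphX {n : ℕ} (hn : 0 < n) :
    IsRainbowDominationRegular (graphX n) 3 := by
  classical
  have : NeZero n := ⟨hn.ne'⟩
  have hreg : (graphX n).IsRegularOfDegree 3 := by
    intro u
    have : (graphX n).neighborFinset u = Finset.univ.image fun s => u * genX n s := by
      ext v
      simp [graphX_adj, eq_comm]
    rw [← SimpleGraph.card_neighborFinset_eq_degree, this, Finset.card_image_of_injective _
      fun s t h => mul_genX_inj.1 h]
    rfl
  have hcard : Fintype.card (Equiv.Perm (Fin 3) × DihedralGroup n) = 12 * n := by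
    rw [← Nat.card_eq_fintype_card, natCard_graphX]
  refine ⟨inferInstance, inferInstance, hreg, ?_⟩
  have hle : rainbowDominationNumber (graphX n) 3 ≤ 6 * n := by
    refine Nat.sInf_le ⟨fun v => oddPermColour v.1, ?_, ?_⟩
    · intro v hv c
      obtain ⟨s, hs⟩ := exists_mem_oddPermColour v.1 hv c
      exact ⟨v * genX n s, graphX_adj_mul v s, by rwa [← fst_genX n, ← Prod.fst_mul] at hs⟩
    · rw [rainbowWeight, Fintype.sum_prod_type]
      simp only [Finset.sum_const, Finset.card_univ, DihedralGroup.card, smul_eq_mul]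
      rw [← Finset.mul_sum, sum_card_oddPermColour]
      ring
  obtain ⟨f, hf, hw⟩ := Nat.sInf_mem (exists_rainbowWeight (graphX n) 3)
  have hge := card_le_two_mul_rainbowWeight (by norm_num) hreg hf
  rw [hw] at hge
  change _ ≤ 2 * rainbowDominationNumber (graphX n) 3 at hge
  omega

/-! ### Reduced closed walks as words in the generators -/

/-- A closed walk of length `k` all of whose corners are proper turns. -/
def IsReducedCycle {V : Type*} (G : SimpleGraph V) {k : ℕ} [NeZero k] (p : Fin k → V) : Prop :=
  ∀ i, G.Adj (p i) (p (i + 1)) ∧ p i ≠ p (i + 2)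

theorem IsReducedCycle.map {V W : Type*} {G : SimpleGraph V} {H : SimpleGraph W} {k : ℕ} [NeZero k]
    {p : Fin k → V} (hp : IsReducedCycle G p) (φ : G ≃g H) : IsReducedCycle H (φ ∘ p) := fun i =>
  ⟨φ.map_adj_iff.2 (hp i).1, fun h => (hp i).2 (φ.injective h)⟩

/-- The reduced closed walks of `graphX n` are given by the reduced words in the generators. -/
theorem IsReducedCycle.exists_word {n k : ℕ} [NeZero k]
    {p : Fin k → Equiv.Perm (Fin 3) × DihedralGroup n} (hp : IsReducedCycle (graphX n) p) :
    ∃ s : Fin k → Fin 3, (∀ i, p (i + 1) = p i * genX n (s i)) ∧ ∀ i, s i ≠ s (i + 1) := by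
  choose s hs using fun i => graphX_adj.1 (hp i).1
  refine ⟨s, hs, fun i h => (hp i).2 ?_⟩
  -- The numeral `2` in `Fin k` means `2 % k`, so this needs an argument for general `k`.
  have h2 : i + 2 = i + 1 + 1 := by rw [add_assoc]; congr 1; exact Fin.ext (Nat.add_mod 1 1 k)
  rw [h2, hs, hs, ← h, mul_assoc, genX_mul_self, mul_one]

/-! ### Relations lifted to the infinite dihedral group -/

/-- The reduction of a dihedral group modulo a divisor. -/
def DihedralGroup.reduce {m n : ℕ} (h : m ∣ n) : DihedralGroup n →* DihedralGroup m where
  toFun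
    | .r i => .r (ZMod.castHom h (ZMod m) i)
    | .sr i => .sr (ZMod.castHom h (ZMod m) i)
  map_one' := by
    rw [DihedralGroup.one_def]
    simp only [map_zero]
    rfl
  map_mul' := by
    rintro (i | i) (j | j) <;> simp [-ZMod.castHom_apply]

/-- The covering map from `graphX n` to `graphX m` for a divisor `m` of `n`. -/
def reduceX {m n : ℕ} (h : m ∣ n) :
    Equiv.Perm (Fin 3) × DihedralGroup n →* Equiv.Perm (Fin 3) × DihedralGroup m :=
  (MonoidHom.id _).prodMap (DihedralGroup.reduce h)

theorem reduceX_genX {m n : ℕ} (h : m ∣ n) (s : Fin 3) : reduceX h (genX n s) = genX m s := by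
  fin_cases s
  · exact Prod.ext rfl (map_one (DihedralGroup.reduce h))
  · exact Prod.ext rfl (congrArg DihedralGroup.sr (map_zero (ZMod.castHom h (ZMod m))))
  · exact Prod.ext rfl (congrArg DihedralGroup.sr (by
      rw [zero_add, zero_add, map_one]))

/-- The angle of a rotation of the infinite dihedral group, up to sign. -/
def DihedralGroup.angle : DihedralGroup 0 → ℕ
  | .r i => Int.natAbs i
  | .sr _ => 0

/-- A rotation that becomes trivial has angle divisible by `n`. The value `0` given to reflections
is harmless, since a reflection reduces to a reflection and never to `1`. -/
theorem DihedralGroup.eq_one_of_reduce_eq_one {n : ℕ} {x : DihedralGroup 0}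
    (hx : reduce (n.dvd_zero) x = 1) (h : x.angle < n) : x = 1 := by
  rcases x with i | i
  · have h0 : (Int.cast (R := ZMod n) (show ℤ from i)) = 0 := by
      have := DihedralGroup.r.inj (hx.trans DihedralGroup.one_def)
      exact this
    rw [ZMod.intCast_zmod_eq_zero_iff_dvd] at h0
    have : (show ℤ from i) = 0 := Int.eq_zero_of_dvd_of_natAbs_lt_natAbs h0 h
    exact congrArg DihedralGroup.r this
  · exact absurd (hx.trans DihedralGroup.one_def) (fun h => by cases h)

/-- A reduced word of length six that starts or ends with the first generator is not the identity in
`graphX 0`, and rotates by at most two steps. -/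
theorem genX_hexagon_words : ∀ s₀ s₁ : Fin 3, s₀ ≠ s₁ → ∀ s₂, s₁ ≠ s₂ → ∀ s₃, s₂ ≠ s₃ →
    ∀ s₄, s₃ ≠ s₄ → ∀ s₅, s₄ ≠ s₅ → s₅ ≠ s₀ → s₀ = 0 ∨ s₅ = 0 →
    (genX 0 s₀ * genX 0 s₁ * genX 0 s₂ * genX 0 s₃ * genX 0 s₄ * genX 0 s₅).2.angle ≤ 2 ∧
    genX 0 s₀ * genX 0 s₁ * genX 0 s₂ * genX 0 s₃ * genX 0 s₄ * genX 0 s₅ ≠ 1 := by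
  decide

/-- The reduced octagons of `graphX 0` that start with the second and third generators, together
with a bound for the rotation by a reduced word of length eight that starts like this. -/
theorem genX_octagon_words : ∀ s₀ s₁ : Fin 3, s₀ ≠ 0 → s₁ ≠ 0 → s₀ ≠ s₁ → ∀ s₂, s₁ ≠ s₂ →
    ∀ s₃, s₂ ≠ s₃ → ∀ s₄, s₃ ≠ s₄ → ∀ s₅, s₄ ≠ s₅ → ∀ s₆, s₅ ≠ s₆ → ∀ s₇, s₆ ≠ s₇ → s₇ ≠ s₀ →
    (genX 0 s₀ * genX 0 s₁ * genX 0 s₂ * genX 0 s₃ * genX 0 s₄ * genX 0 s₅ * genX 0 s₆ *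
      genX 0 s₇).2.angle ≤ 4 ∧
    (genX 0 s₀ * genX 0 s₁ * genX 0 s₂ * genX 0 s₃ * genX 0 s₄ * genX 0 s₅ * genX 0 s₆ *
      genX 0 s₇ = 1 →
    [s₃, s₄, s₅, s₆, s₇] = if s₂ = 0 then [s₁, s₀, s₁, 0, s₁] else [0, s₀, s₁, s₀, 0]) := by
  decide

/-- This transfers the computations over `DihedralGroup 0` to every `n` larger than the rotation
bound. -/
theorem eq_one_of_reduceX_eq_one {n : ℕ} {x : Equiv.Perm (Fin 3) × DihedralGroup 0}
    (hx : reduceX n.dvd_zero x = 1) (h : x.2.angle < n) : x = 1 :=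
  Prod.ext (congrArg (fun y => y.1) hx)
    (DihedralGroup.eq_one_of_reduce_eq_one (congrArg (fun y => y.2) hx) h)

/-- In `graphX n` no reduced hexagon uses an edge of the first kind. -/
theorem not_genX_zero_of_hexagon {n : ℕ} (hn : 3 ≤ n)
    {p : Fin 6 → Equiv.Perm (Fin 3) × DihedralGroup n} (hp : IsReducedCycle (graphX n) p) :
    p 1 ≠ p 0 * genX n 0 ∧ p 5 ≠ p 0 * genX n 0 := by
  obtain ⟨s, hs, hne⟩ := hp.exists_word
  have h1 : p 1 = p 0 * genX n (s 0) := hs 0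
  have h2 : p 2 = p 1 * genX n (s 1) := hs 1
  have h3 : p 3 = p 2 * genX n (s 2) := hs 2
  have h4 : p 4 = p 3 * genX n (s 3) := hs 3
  have h5 : p 5 = p 4 * genX n (s 4) := hs 4
  have h0 : p 0 = p 5 * genX n (s 5) := hs 5
  have h5' : p 5 = p 0 * genX n (s 5) := by rw [h0, mul_assoc, genX_mul_self, mul_one]
  have hw : genX n (s 0) * genX n (s 1) * genX n (s 2) * genX n (s 3) * genX n (s 4) *
      genX n (s 5) = 1 := by
    have h : p 0 * (genX n (s 0) * genX n (s 1) * genX n (s 2) * genX n (s 3) * genX n (s 4) *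
        genX n (s 5)) = p 0 := by
      simp only [← mul_assoc, ← h1, ← h2, ← h3, ← h4, ← h5, ← h0]
    simpa using h
  have key : ¬ (s 0 = 0 ∨ s 5 = 0) := by
    intro h
    obtain ⟨hangle, hW⟩ := genX_hexagon_words (s 0) (s 1) (hne 0) (s 2) (hne 1) (s 3) (hne 2)
      (s 4) (hne 3) (s 5) (hne 4) (hne 5) h
    refine hW (eq_one_of_reduceX_eq_one (n := n) ?_ (by omega))
    simpa only [map_mul, reduceX_genX] using hw
  rw [h1, h5', Ne, Ne, mul_genX_inj, mul_genX_inj]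
  exact not_or.1 key

/-- Reduced octagons of `graphX n`, `5 ≤ n`, whose first two steps are not of the first kind are
determined by their first three steps. -/
theorem octagon_eq {n : ℕ} (hn : 5 ≤ n)
    {p q : Fin 8 → Equiv.Perm (Fin 3) × DihedralGroup n} (hp : IsReducedCycle (graphX n) p)
    (hq : IsReducedCycle (graphX n) q) (h0 : p 0 = q 0) (h1 : p 1 = q 1) (h2 : p 2 = q 2)
    (h3 : p 3 = q 3) (hp1 : p 1 ≠ p 0 * genX n 0) (hp2 : p 2 ≠ p 1 * genX n 0) : p = q := by
  have key : ∀ {p : Fin 8 → Equiv.Perm (Fin 3) × DihedralGroup n},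
      IsReducedCycle (graphX n) p → p 1 ≠ p 0 * genX n 0 → p 2 ≠ p 1 * genX n 0 →
      ∃ s : Fin 8 → Fin 3, (∀ i, p (i + 1) = p i * genX n (s i)) ∧
      [s 3, s 4, s 5, s 6, s 7] =
        if s 2 = 0 then [s 1, s 0, s 1, 0, s 1] else [0, s 0, s 1, s 0, 0] := by
    intro p hp hp1 hp2
    obtain ⟨s, hs, hne⟩ := hp.exists_word
    refine ⟨s, hs, ?_⟩
    have h1 : p 1 = p 0 * genX n (s 0) := hs 0
    have h2 : p 2 = p 1 * genX n (s 1) := hs 1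
    have h3 : p 3 = p 2 * genX n (s 2) := hs 2
    have h4 : p 4 = p 3 * genX n (s 3) := hs 3
    have h5 : p 5 = p 4 * genX n (s 4) := hs 4
    have h6 : p 6 = p 5 * genX n (s 5) := hs 5
    have h7 : p 7 = p 6 * genX n (s 6) := hs 6
    have h0 : p 0 = p 7 * genX n (s 7) := hs 7
    have hw : genX n (s 0) * genX n (s 1) * genX n (s 2) * genX n (s 3) * genX n (s 4) *
        genX n (s 5) * genX n (s 6) * genX n (s 7) = 1 := by
      have h : p 0 * (genX n (s 0) * genX n (s 1) * genX n (s 2) * genX n (s 3) * genX n (s 4) *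
          genX n (s 5) * genX n (s 6) * genX n (s 7)) = p 0 := by
        simp only [← mul_assoc, ← h1, ← h2, ← h3, ← h4, ← h5, ← h6, ← h7, ← h0]
      simpa using h
    rw [h1, Ne, mul_genX_inj] at hp1
    rw [h2, Ne, mul_genX_inj] at hp2
    -- The two shapes of octagon say that `s₀` commutes with `s₁ a s₁`, or that `s₀ s₁ s₀` commutes
    -- with `a`. The rotation bound `4` is what requires `5 ≤ n`.
    obtain ⟨hangle, hW⟩ := genX_octagon_words (s 0) (s 1) hp1 hp2 (hne 0) (s 2) (hne 1) (s 3)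
      (hne 2) (s 4) (hne 3) (s 5) (hne 4) (s 6) (hne 5) (s 7) (hne 6) (hne 7)
    refine hW (eq_one_of_reduceX_eq_one (n := n) ?_ (by omega))
    simpa only [map_mul, reduceX_genX] using hw
  obtain ⟨s, hs, hsw⟩ := key hp hp1 hp2
  obtain ⟨t, ht, htw⟩ := key hq (by rwa [← h0, ← h1]) (by rwa [← h1, ← h2])
  have e0 : s 0 = t 0 := mul_genX_inj.1 ((hs 0).symm.trans (h1.trans ((ht 0).trans (by rw [h0]))))
  have e1 : s 1 = t 1 := mul_genX_inj.1 ((hs 1).symm.trans (h2.trans ((ht 1).trans (by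
    rw [← h1]))))
  have e2 : s 2 = t 2 := mul_genX_inj.1 ((hs 2).symm.trans (h3.trans ((ht 2).trans (by rw [h2]))))
  rw [← e0, ← e1, ← e2, ← hsw] at htw
  simp only [List.cons.injEq, and_true] at htw
  obtain ⟨e3, e4, e5, e6, -⟩ := htw
  have h4 : p 4 = q 4 := (hs 3).trans (by rw [h3, ← e3]; exact (ht 3).symm)
  have h5 : p 5 = q 5 := (hs 4).trans (by rw [h4, ← e4]; exact (ht 4).symm)
  have h6 : p 6 = q 6 := (hs 5).trans (by rw [h5, ← e5]; exact (ht 5).symm)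
  have h7 : p 7 = q 7 := (hs 6).trans (by rw [h6, ← e6]; exact (ht 6).symm)
  funext i
  fin_cases i <;> assumption

/-! ### Recognising the edges of the first kind -/

/-- A relation on the vertices of a graph that in `graphX (3 * m)` picks out the edges of the first
kind: the edge lies in no reduced hexagon, and each of its extensions by a step has a further
extension that lies in two octagons. -/
def IsOctagonRich {V : Type*} (G : SimpleGraph V) (x y : V) : Prop :=
  (∀ p : Fin 6 → V, IsReducedCycle G p → p 0 = x → p 1 ≠ y) ∧
  ∀ z, G.Adj y z → z ≠ x → ∃ p q : Fin 8 → V, IsReducedCycle G p ∧ IsReducedCycle G q ∧ p ≠ q ∧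
    p 0 = x ∧ q 0 = x ∧ p 1 = y ∧ q 1 = y ∧ p 2 = z ∧ q 2 = z ∧ p 3 = q 3

theorem IsOctagonRich.map {V W : Type*} {G : SimpleGraph V} {H : SimpleGraph W} {x y : V}
    (h : IsOctagonRich G x y) (φ : G ≃g H) : IsOctagonRich H (φ x) (φ y) := by
  refine ⟨fun p hp h0 h1 => h.1 _ (hp.map φ.symm) (by simp [h0]) (by simp [h1]), fun z hz hzx => ?_⟩
  obtain ⟨p, q, hp, hq, hpq, h0, h0', h1, h1', h2, h2', h3⟩ := h.2 (φ.symm z)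
    (by rw [← φ.map_adj_iff]; simpa using hz) (by rintro rfl; simp at hzx)
  refine ⟨φ ∘ p, φ ∘ q, hp.map φ, hq.map φ, fun e => hpq (φ.injective.comp_left e), ?_⟩
  simp [h0, h0', h1, h1', h2, h2', h3]

theorem isOctagonRich_map_iff {V W : Type*} {G : SimpleGraph V} {H : SimpleGraph W} {x y : V}
    (φ : G ≃g H) : IsOctagonRich H (φ x) (φ y) ↔ IsOctagonRich G x y :=
  ⟨fun h => by simpa using h.map φ.symm, fun h => h.map φ⟩

/-- A reduced word of length `k` that represents the identity gives a reduced closed walk. -/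
theorem isReducedCycle_of_word {n k : ℕ} [NeZero k]
    {p : Fin k → Equiv.Perm (Fin 3) × DihedralGroup n} {s : Fin k → Fin 3}
    (hs : ∀ i, p (i + 1) = p i * genX n (s i)) (hne : ∀ i, s i ≠ s (i + 1)) :
    IsReducedCycle (graphX n) p := by
  intro i
  refine ⟨graphX_adj.2 ⟨s i, hs i⟩, fun h => hne i ?_⟩
  have h2 : i + 2 = i + 1 + 1 := by rw [add_assoc]; congr 1; exact Fin.ext (Nat.add_mod 1 1 k)
  have h3 := hs (i + 1)
  rw [← h2, ← h, hs i, mul_assoc] at h3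
  have h4 : genX n (s i) * genX n (s (i + 1)) = genX n (s i) * genX n (s i) := by
    rw [genX_mul_self]; simpa using h3.symm
  exact (genX_injective n (mul_left_cancel h4)).symm

/-- A relation over the infinite dihedral group survives reduction, so it gives an octagon at every
vertex for every `n`. -/
theorem genX_octagon {n : ℕ} {s : Fin 8 → Fin 3} (x : Equiv.Perm (Fin 3) × DihedralGroup n)
    (hne : ∀ i, s i ≠ s (i + 1))
    (hs : genX 0 (s 0) * genX 0 (s 1) * genX 0 (s 2) * genX 0 (s 3) * genX 0 (s 4) *
      genX 0 (s 5) * genX 0 (s 6) * genX 0 (s 7) = 1) :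
    ∃ p : Fin 8 → Equiv.Perm (Fin 3) × DihedralGroup n, IsReducedCycle (graphX n) p ∧
      p 0 = x ∧ ∀ i, p (i + 1) = p i * genX n (s i) := by
  have hw := congrArg (reduceX n.dvd_zero) hs
  simp only [map_mul, reduceX_genX, map_one] at hw
  refine ⟨![x, x * genX n (s 0), x * genX n (s 0) * genX n (s 1),
    x * genX n (s 0) * genX n (s 1) * genX n (s 2),
    x * genX n (s 0) * genX n (s 1) * genX n (s 2) * genX n (s 3),
    x * genX n (s 0) * genX n (s 1) * genX n (s 2) * genX n (s 3) * genX n (s 4),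
    x * genX n (s 0) * genX n (s 1) * genX n (s 2) * genX n (s 3) * genX n (s 4) * genX n (s 5),
    x * genX n (s 0) * genX n (s 1) * genX n (s 2) * genX n (s 3) * genX n (s 4) * genX n (s 5) *
      genX n (s 6)], (fun h => ⟨isReducedCycle_of_word h hne, rfl, h⟩) ?_⟩
  intro i
  fin_cases i
  -- Only the step closing the walk uses the relation.
  on_goal 8 =>
    change x = x * genX n (s 0) * genX n (s 1) * genX n (s 2) * genX n (s 3) * genX n (s 4) *
      genX n (s 5) * genX n (s 6) * genX n (s 7)
    simp only [mul_assoc] at hw ⊢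
    rw [hw, mul_one]
  all_goals rfl

theorem isOctagonRich_graphX {n : ℕ} (hn : 3 ≤ n) (x : Equiv.Perm (Fin 3) × DihedralGroup n) :
    IsOctagonRich (graphX n) x (x * genX n 0) := by
  refine ⟨fun p hp h0 h1 => (not_genX_zero_of_hexagon hn hp).1 (by rw [h0, h1]), fun z hz hzx => ?_⟩
  obtain ⟨t, rfl⟩ := graphX_adj.1 hz
  have ht : t ≠ 0 := by
    rintro rfl
    exact hzx (by rw [mul_assoc, genX_mul_self, mul_one])
  have key : ∀ t : Fin 3, t ≠ 0 → ∃ s s' : Fin 8 → Fin 3,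
      (∀ i, s i ≠ s (i + 1)) ∧ (∀ i, s' i ≠ s' (i + 1)) ∧
      (genX 0 (s 0) * genX 0 (s 1) * genX 0 (s 2) * genX 0 (s 3) * genX 0 (s 4) *
        genX 0 (s 5) * genX 0 (s 6) * genX 0 (s 7) = 1) ∧
      (genX 0 (s' 0) * genX 0 (s' 1) * genX 0 (s' 2) * genX 0 (s' 3) * genX 0 (s' 4) *
        genX 0 (s' 5) * genX 0 (s' 6) * genX 0 (s' 7) = 1) ∧
      s 0 = 0 ∧ s 1 = t ∧ s' 0 = 0 ∧ s' 1 = t ∧ s 2 = s' 2 ∧ s 3 ≠ s' 3 := by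
    intro t ht
    match t with
    | 0 => exact absurd rfl ht
    -- Conjugation by `a` swaps `b` and `c` in `S₃` and fixes the dihedral components. Hence
    -- `(aba)b(aca)c` and `(aba)c(aca)b` are both trivial; they part at the fourth letter. The case
    -- `2` exchanges `b` and `c`.
    | 1 => exact ⟨![0, 1, 0, 1, 0, 2, 0, 2], ![0, 1, 0, 2, 0, 2, 0, 1], by decide⟩
    | 2 => exact ⟨![0, 2, 0, 2, 0, 1, 0, 1], ![0, 2, 0, 1, 0, 1, 0, 2], by decide⟩
  obtain ⟨s, s', hne, hne', hw, hw', h0, h1, h0', h1', h2, h3⟩ := key t ht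
  obtain ⟨p, hp, hp0, hps⟩ := genX_octagon x hne hw
  obtain ⟨q, hq, hq0, hqs⟩ := genX_octagon x hne' hw'
  have p1 : p 1 = x * genX n 0 := (hps 0).trans (by rw [hp0, h0])
  have q1 : q 1 = x * genX n 0 := (hqs 0).trans (by rw [hq0, h0'])
  have p2 : p 2 = x * genX n 0 * genX n t := (hps 1).trans (by rw [p1, h1])
  have q2 : q 2 = x * genX n 0 * genX n t := (hqs 1).trans (by rw [q1, h1'])
  have p3 : p 3 = q 3 := (hps 2).trans (by rw [p2, ← q2, h2]; exact (hqs 2).symm)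
  refine ⟨p, q, hp, hq, fun e => h3 ?_, hp0, hq0, p1, q1, p2, q2, p3⟩
  refine mul_genX_inj.1 ((hps 3).symm.trans ((congrFun e 4).trans ((hqs 3).trans ?_)))
  rw [p3]

/-- The second and third generators span cycles of length `6 * m` in `graphX (3 * m)`. -/
theorem genX_mul_genX_pow (m : ℕ) {s t : Fin 3} (hs : s ≠ 0) (ht : t ≠ 0) (hst : s ≠ t) :
    (genX (3 * m) s * genX (3 * m) t) ^ (3 * m) = 1 := by
  have key : (genX (3 * m) 1 * genX (3 * m) 2) ^ (3 * m) = 1 := by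
    have hσ : (Equiv.swap (0 : Fin 3) 2 * Equiv.swap (1 : Fin 3) 2) ^ 3 = 1 := by decide
    refine Prod.ext ?_ ?_
    · change (Equiv.swap (0 : Fin 3) 2 * Equiv.swap (1 : Fin 3) 2) ^ (3 * m) = 1
      rw [pow_mul, hσ, one_pow]
    · change (DihedralGroup.sr 0 * (DihedralGroup.sr 0 * DihedralGroup.r 1)) ^ (3 * m) = 1
      rw [← mul_assoc, DihedralGroup.sr_mul_self, one_mul, DihedralGroup.r_one_pow_n]
  have hinv : genX (3 * m) 2 * genX (3 * m) 1 = (genX (3 * m) 1 * genX (3 * m) 2)⁻¹ := by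
    rw [mul_inv_rev, ← eq_inv_of_mul_eq_one_left (genX_mul_self _ 1),
      ← eq_inv_of_mul_eq_one_left (genX_mul_self _ 2)]
  have hcases : ∀ s t : Fin 3, s ≠ 0 → t ≠ 0 → s ≠ t → s = 1 ∧ t = 2 ∨ s = 2 ∧ t = 1 := by decide
  rcases hcases s t hs ht hst with ⟨rfl, rfl⟩ | ⟨rfl, rfl⟩
  · exact key
  · rw [hinv, inv_pow, key, inv_one]

/-- For `m = 1` the relation `(st)³ = 1` puts the edge on a hexagon. For `m ≥ 2` one has `3m ≥ 5`,
and extending by the other letter among `b`, `c` contradicts the uniqueness in `octagon_eq`. -/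
theorem not_isOctagonRich_graphX {m : ℕ} (hm : 1 ≤ m) {s : Fin 3} (hs : s ≠ 0)
    (x : Equiv.Perm (Fin 3) × DihedralGroup (3 * m)) :
    ¬ IsOctagonRich (graphX (3 * m)) x (x * genX (3 * m) s) := by
  obtain ⟨t, ht, hst⟩ : ∃ t : Fin 3, t ≠ 0 ∧ s ≠ t := by revert s; decide
  rintro ⟨hhex, hoct⟩
  rcases hm.eq_or_lt with rfl | hm
  · have hw := genX_mul_genX_pow 1 hs ht hst
    rw [show (genX (3 * 1) s * genX (3 * 1) t) ^ (3 * 1) = genX (3 * 1) s * genX (3 * 1) t *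
      (genX (3 * 1) s * genX (3 * 1) t) * (genX (3 * 1) s * genX (3 * 1) t) from pow_three' _] at hw
    refine hhex ![x, x * genX _ s, x * genX _ s * genX _ t, x * genX _ s * genX _ t * genX _ s,
      x * genX _ s * genX _ t * genX _ s * genX _ t,
      x * genX _ s * genX _ t * genX _ s * genX _ t * genX _ s]
      (isReducedCycle_of_word (s := ![s, t, s, t, s, t]) ?_ ?_) rfl rfl
    · intro i
      fin_cases i
      on_goal 6 =>
        change x = x * genX _ s * genX _ t * genX _ s * genX _ t * genX _ s * genX _ t
        have hx := congrArg (x * ·) hw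
        simp only [← mul_assoc] at hx
        rw [hx]
        exact (mul_one x).symm
      all_goals rfl
    · intro i
      fin_cases i
      exacts [hst, hst.symm, hst, hst.symm, hst, hst.symm]
  · obtain ⟨p, q, hp, hq, hpq, h0, h0', h1, h1', h2, h2', h3⟩ := hoct (x * genX _ s * genX _ t)
      (graphX_adj_mul _ t) (fun h => hst (by
        rw [mul_assoc, mul_eq_left] at h
        rw [← genX_mul_self _ s] at h
        exact (genX_injective _ (mul_left_cancel h)).symm))
    refine hpq (octagon_eq (by omega) hp hq (h0.trans h0'.symm) (h1.trans h1'.symm)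
      (h2.trans h2'.symm) h3 ?_ ?_)
    · rw [h1, h0, Ne, mul_genX_inj]
      exact hs
    · rw [h2, h1, Ne, mul_genX_inj]
      exact ht

/-! ### Isomorphisms to other graphs; honeycomb toroidal graphs -/

theorem exists_eq_mul_genX_of_adj_iso {n : ℕ} {V : Type*} {H : SimpleGraph V} (φ : graphX n ≃g H)
    {u v : V} (h : H.Adj u v) : ∃ s, φ.symm v = φ.symm u * genX n s :=
  graphX_adj.1 (φ.symm.map_adj_iff.2 h)

/-- A graph with a vertex that has at most two neighbours is not isomorphic to `graphX n`. -/
theorem isEmpty_iso_of_adj_imp {n : ℕ} {V : Type*} {H : SimpleGraph V} {v x y : V}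
    (h : ∀ w, H.Adj v w → w = x ∨ w = y) : IsEmpty (graphX n ≃g H) := by
  refine ⟨fun φ => ?_⟩
  have key : ∀ s, φ (φ.symm v * genX n s) = x ∨ φ (φ.symm v * genX n s) = y := fun s =>
    h _ (by
      have := φ.map_adj_iff.2 (graphX_adj_mul (φ.symm v) s)
      rwa [RelIso.apply_symm_apply] at this)
  have inj : ∀ s t, φ (φ.symm v * genX n s) = φ (φ.symm v * genX n t) → s = t := fun s t h =>
    mul_genX_inj.1 (φ.injective h)
  rcases key 0 with h0 | h0 <;> rcases key 1 with h1 | h1 <;> rcases key 2 with h2 | h2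
  all_goals first
    | exact absurd (inj 0 1 (h0.trans h1.symm)) (by decide)
    | exact absurd (inj 0 2 (h0.trans h2.symm)) (by decide)
    | exact absurd (inj 1 2 (h1.trans h2.symm)) (by decide)

/-- A graph with two parallel walks that are joined by rungs at the odd positions contains two
hexagons whose edges at a common vertex go to three distinct neighbours. -/
theorem isEmpty_iso_of_ladder {n : ℕ} (hn : 3 ≤ n) {V : Type*} {H : SimpleGraph V} {P Q : ℕ → V}
    (hP : ∀ j, H.Adj (P j) (P (j + 1))) (hQ : ∀ j, H.Adj (Q j) (Q (j + 1)))
    (hPQ : ∀ j, Odd j → H.Adj (P j) (Q j)) (hP2 : ∀ j, P j ≠ P (j + 2))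
    (hQ2 : ∀ j, Q j ≠ Q (j + 2)) (h₁ : ∀ j, P j ≠ Q (j + 1)) (h₂ : ∀ j, P (j + 1) ≠ Q j) :
    IsEmpty (graphX n ≃g H) := by
  refine ⟨fun φ => ?_⟩
  have hr1 := hPQ 1 (by decide)
  have hr3 := hPQ 3 (by decide)
  have hr5 := hPQ 5 (by decide)
  -- The two hexagons lie on either side of the rung at `3`. Only backtracking is excluded, so other
  -- coincidences of vertices do no harm.
  have hex : IsReducedCycle H ![P 3, P 2, P 1, Q 1, Q 2, Q 3] := by
    intro i
    fin_cases i
    exacts [⟨(hP 2).symm, (hP2 1).symm⟩, ⟨(hP 1).symm, h₂ 1⟩, ⟨hr1, h₁ 1⟩, ⟨hQ 1, hQ2 1⟩,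
      ⟨hQ 2, (h₂ 2).symm⟩, ⟨hr3.symm, (h₁ 2).symm⟩]
  have hex' : IsReducedCycle H ![P 3, P 4, P 5, Q 5, Q 4, Q 3] := by
    intro i
    fin_cases i
    exacts [⟨hP 3, hP2 3⟩, ⟨hP 4, h₁ 4⟩, ⟨hr5, h₂ 4⟩, ⟨(hQ 4).symm, (hQ2 3).symm⟩,
      ⟨(hQ 3).symm, (h₁ 3).symm⟩, ⟨hr3.symm, (h₂ 3).symm⟩]
  have e1 := not_genX_zero_of_hexagon hn (hex.map φ.symm)
  have e2 := not_genX_zero_of_hexagon hn (hex'.map φ.symm)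
  have n1 : φ.symm (P 2) ≠ φ.symm (P 3) * genX n 0 := e1.1
  have n2 : φ.symm (Q 3) ≠ φ.symm (P 3) * genX n 0 := e1.2
  have n3 : φ.symm (P 4) ≠ φ.symm (P 3) * genX n 0 := e2.1
  obtain ⟨s, hs⟩ := exists_eq_mul_genX_of_adj_iso φ (hP 2).symm
  obtain ⟨t, ht⟩ := exists_eq_mul_genX_of_adj_iso φ (hP 3)
  obtain ⟨u, hu⟩ := exists_eq_mul_genX_of_adj_iso φ hr3
  rw [hs, Ne, mul_genX_inj] at n1
  rw [hu, Ne, mul_genX_inj] at n2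
  rw [ht, Ne, mul_genX_inj] at n3
  have hst : s ≠ t := by
    rintro rfl
    exact hP2 2 (φ.symm.injective (hs.trans ht.symm))
  have hsu : s ≠ u := by
    rintro rfl
    exact h₁ 2 (φ.symm.injective (hs.trans hu.symm))
  have htu : t ≠ u := by
    rintro rfl
    exact h₂ 3 (φ.symm.injective (ht.trans hu.symm))
  -- Three distinct elements of `Fin 3` cannot all be nonzero.
  revert s t u
  omega

/-- Evenness of `n` makes the parity of a residue well defined, so rungs can be read off from
natural indices. -/
theorem ZMod.natCast_val_modEq_two {n : ℕ} (hn : Even n) (j : ℕ) :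
    ((j : ℕ) : ZMod n).val ≡ j [MOD 2] := by
  rw [ZMod.val_natCast]
  exact (Nat.mod_modEq j n).of_dvd hn.two_dvd

theorem ZMod.natCast_ne_zero_of_lt {n a : ℕ} (h0 : 0 < a) (h : a < n) : (a : ZMod n) ≠ 0 := by
  rw [Ne, ZMod.natCast_eq_zero_iff]
  exact Nat.not_dvd_of_pos_of_lt h0 h

theorem honeycombToroidal_adj_vertical {m n l : ℕ} (hn : 2 ≤ n) (i : ZMod m) (j : ZMod n) :
    (honeycombToroidal m n l).Adj (i, j) (i, j + 1) := by
  have h1 := ZMod.natCast_ne_zero_of_lt (n := n) one_pos hn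
  rw [honeycombToroidal, SimpleGraph.fromRel_adj]
  refine ⟨fun h => h1 ?_, Or.inl (Or.inl ⟨i, j, rfl, rfl⟩)⟩
  simpa using congrArg Prod.snd h

/-- With at least two columns, columns `0` and `1` form the ladder. With one column, its translate
by `l` is the second side and the jumps are the rungs. -/
theorem isEmpty_graphX_iso_honeycombToroidal {r m n l : ℕ} (hr : 3 ≤ r) (hm : 1 ≤ m) (hn : 4 ≤ n)
    (hn2 : Even n) (hl : 2 * l ≤ n) (hlm : l ≡ m [MOD 2]) :
    IsEmpty (graphX r ≃g honeycombToroidal m n l) := by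
  have hn' : 2 ≤ n := by omega
  have h1 : ((1 : ℕ) : ZMod n) ≠ 0 := ZMod.natCast_ne_zero_of_lt one_pos hn'
  have h2 : ((2 : ℕ) : ZMod n) ≠ 0 := ZMod.natCast_ne_zero_of_lt two_pos (by omega)
  rcases hm.eq_or_lt with rfl | hm
  · have hlodd : l % 2 = 1 := hlm
    -- For `l = 1` each jump is also a vertical edge. Otherwise `l` is odd and at least `3`, so `2 *
    -- l ≤ n` makes `l - 1`, `l` and `l + 1` nonzero modulo `n`.
    by_cases hl1 : l = 1
    · subst hl1
      refine isEmpty_iso_of_adj_imp (v := (0, 0)) (x := (0, 1)) (y := (0, -1)) ?_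
      rintro ⟨i, j⟩ h
      have hi : i = 0 := Subsingleton.elim _ _
      subst hi
      rw [honeycombToroidal, SimpleGraph.fromRel_adj] at h
      simp only [Prod.mk.injEq] at h ⊢
      rcases h.2 with (⟨i, k, h, h'⟩ | ⟨i, k, h, -⟩ | ⟨i, k, -, -, h, h'⟩) |
        (⟨i, k, h, h'⟩ | ⟨i, k, h, -⟩ | ⟨i, k, -, -, h, h'⟩)
      · exact Or.inl ⟨trivial, by rw [h'.2, ← h.2, zero_add]⟩
      · omega
      · exact Or.inl ⟨trivial, by rw [h'.2, ← h.2, zero_add, Nat.cast_one]⟩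
      · exact Or.inr ⟨trivial, by rw [h.2]; exact eq_neg_of_add_eq_zero_left h'.2.symm⟩
      · omega
      · exact Or.inr ⟨trivial, by
          rw [h.2]
          exact eq_neg_of_add_eq_zero_left (by simpa using h'.2.symm)⟩
    · have hl0 : (l : ZMod n) ≠ 0 := ZMod.natCast_ne_zero_of_lt (by omega) (by omega)
      have hlp : ((l + 1 : ℕ) : ZMod n) ≠ 0 := ZMod.natCast_ne_zero_of_lt (by omega) (by omega)
      have hlq : ((l - 1 : ℕ) : ZMod n) ≠ 0 := ZMod.natCast_ne_zero_of_lt (by omega) (by omega)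
      rw [Nat.cast_sub (by omega)] at hlq
      push_cast at hlp hlq h2
      refine isEmpty_iso_of_ladder hr (P := fun j => (0, (j : ZMod n)))
        (Q := fun j => (0, (j : ZMod n) + l)) ?_ ?_ ?_ ?_ ?_ ?_ ?_
      · intro j
        simpa using honeycombToroidal_adj_vertical hn' 0 (j : ZMod n)
      · intro j
        simpa [add_right_comm] using honeycombToroidal_adj_vertical hn' 0 ((j : ZMod n) + l)
      · intro j hj
        rw [honeycombToroidal, SimpleGraph.fromRel_adj]
        refine ⟨fun h => hl0 (by simpa using congrArg Prod.snd h),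
          Or.inl (Or.inr (Or.inr ⟨0, j, rfl, ?_, rfl, rfl⟩))⟩
        exact (ZMod.natCast_val_modEq_two hn2 j).trans (Nat.odd_iff.1 hj)
      · intro j h
        apply h2
        simpa using congrArg Prod.snd h
      · intro j h
        apply h2
        have := congrArg Prod.snd h
        push_cast at this
        linear_combination -this
      · intro j h
        apply hlp
        have := congrArg Prod.snd h
        push_cast at this
        linear_combination -this
      · intro j h
        apply hlq
        have := congrArg Prod.snd h
        push_cast at this
        linear_combination -this
  · have : Fact (1 < m) := ⟨hm⟩
    have h01 : (0 : ZMod m) ≠ 1 := zero_ne_one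
    push_cast at h2
    refine isEmpty_iso_of_ladder hr (P := fun j => (0, (j : ZMod n)))
      (Q := fun j => (1, (j : ZMod n))) ?_ ?_ ?_ ?_ ?_ ?_ ?_
    · intro j
      simpa using honeycombToroidal_adj_vertical hn' 0 (j : ZMod n)
    · intro j
      simpa using honeycombToroidal_adj_vertical hn' 1 (j : ZMod n)
    · intro j hj
      rw [honeycombToroidal, SimpleGraph.fromRel_adj]
      refine ⟨fun h => h01 (congrArg Prod.fst h),
        Or.inl (Or.inr (Or.inl ⟨0, j, ?_, ?_, rfl, by rw [zero_add]⟩))⟩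
      · rw [ZMod.val_zero]
        omega
      · rw [ZMod.val_zero, zero_add]
        have hj1 : j ≡ 1 [MOD 2] := Nat.odd_iff.1 hj
        exact ((ZMod.natCast_val_modEq_two hn2 j).trans hj1).symm
    · intro j h
      apply h2
      simpa using congrArg Prod.snd h
    · intro j h
      apply h2
      simpa using congrArg Prod.snd h
    · exact fun j h => h01 (congrArg Prod.fst h)
    · exact fun j h => h01 (congrArg Prod.fst h)

/-! ### Generalized Petersen graphs -/

theorem generalizedPetersen_adj_outer {n k : ℕ} {i j : ZMod n} :
    (generalizedPetersen n k).Adj (.inl i) (.inl j) ↔ i ≠ j ∧ (j = i + 1 ∨ i = j + 1) := by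
  rw [generalizedPetersen, SimpleGraph.fromRel_adj]
  simp [Sum.inl.injEq]

theorem generalizedPetersen_adj_spoke {n k : ℕ} {i j : ZMod n} :
    (generalizedPetersen n k).Adj (.inl i) (.inr j) ↔ j = i := by
  rw [generalizedPetersen, SimpleGraph.fromRel_adj]
  simp [eq_comm]

theorem generalizedPetersen_adj_inner {n k : ℕ} {i j : ZMod n} :
    (generalizedPetersen n k).Adj (.inr i) (.inr j) ↔ i ≠ j ∧ (j = i + k ∨ i = j + k) := by
  rw [generalizedPetersen, SimpleGraph.fromRel_adj]
  simp

/-- The rotations of a generalized Petersen graph. -/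
def generalizedPetersenRotation (n k : ℕ) (t : ZMod n) :
    generalizedPetersen n k ≃g generalizedPetersen n k where
  toEquiv := Equiv.sumCongr (Equiv.addRight t) (Equiv.addRight t)
  map_rel_iff' := by
    rintro (i | i) (j | j)
    · simp [generalizedPetersen_adj_outer, add_right_comm _ t]
    · simp [generalizedPetersen_adj_spoke]
    · rw [SimpleGraph.adj_comm, SimpleGraph.adj_comm _ (Sum.inr i)]
      simp [generalizedPetersen_adj_spoke]
    · simp [generalizedPetersen_adj_inner, add_right_comm _ t]

theorem isOctagonRich_outer_iff {n k : ℕ} (i j t : ZMod n) :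
    IsOctagonRich (generalizedPetersen n k) (.inl (i + t)) (.inl (j + t)) ↔
      IsOctagonRich (generalizedPetersen n k) (.inl i) (.inl j) :=
  isOctagonRich_map_iff (x := Sum.inl i) (y := Sum.inl j) (generalizedPetersenRotation n k t)

theorem isOctagonRich_graphX_iff {m : ℕ} (hm : 1 ≤ m)
    {x : Equiv.Perm (Fin 3) × DihedralGroup (3 * m)} {s : Fin 3} :
    IsOctagonRich (graphX (3 * m)) x (x * genX (3 * m) s) ↔ s = 0 := by
  refine ⟨fun h => by_contra fun hs => not_isOctagonRich_graphX hm hs x h, ?_⟩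
  rintro rfl
  exact isOctagonRich_graphX (by omega) x

theorem isEmpty_graphX_iso_generalizedPetersen {m n k : ℕ} (hm : 1 ≤ m) (hn : 2 ≤ n) :
    IsEmpty (graphX (3 * m) ≃g generalizedPetersen n k) := by
  refine ⟨fun φ => ?_⟩
  have hnm : n = 18 * m := by
    have : NeZero n := ⟨by omega⟩
    have h := Nat.card_congr φ.toEquiv
    rw [natCard_graphX, Nat.card_sum, Nat.card_zmod] at h
    omega
  have rich_iff : ∀ {x y}, (generalizedPetersen n k).Adj x y →
      (IsOctagonRich (generalizedPetersen n k) x y ↔ φ.symm y = φ.symm x * genX _ 0) := by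
    intro x y hxy
    obtain ⟨s, hs⟩ := exists_eq_mul_genX_of_adj_iso φ hxy
    rw [← isOctagonRich_map_iff φ.symm, hs, isOctagonRich_graphX_iff hm, mul_genX_inj]
  have h1 : ((1 : ℕ) : ZMod n) ≠ 0 := ZMod.natCast_ne_zero_of_lt one_pos hn
  have h2 : ((2 : ℕ) : ZMod n) ≠ 0 := ZMod.natCast_ne_zero_of_lt two_pos (by omega)
  push_cast at h1 h2
  have hadj : ∀ i, (generalizedPetersen n k).Adj (.inl i) (.inl (i + 1)) := fun i =>
    generalizedPetersen_adj_outer.2 ⟨by simpa using h1, Or.inl rfl⟩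
  -- If one outer edge were an `a`-edge, its rotation would make the next one an `a`-edge too; but
  -- two successive `a`-steps return to the start.
  have houter : ∀ i, φ.symm (.inl (i + 1)) ≠ φ.symm (.inl i) * genX _ 0 := by
    intro i h
    have hr := (rich_iff (hadj i)).2 h
    have hr' := (isOctagonRich_outer_iff i (i + 1) 1).2 hr
    have h' := (rich_iff (hadj (i + 1))).1 hr'
    rw [h, mul_assoc, genX_mul_self, mul_one] at h'
    apply h2
    have := Sum.inl.inj (φ.symm.injective h')
    linear_combination this
  choose s hs using fun i => exists_eq_mul_genX_of_adj_iso φ (hadj i)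
  have hs0 : ∀ i, s i ≠ 0 := fun i h => houter i (by rw [hs, h])
  have hne : ∀ i, s i ≠ s (i + 1) := by
    intro i h
    apply h2
    have h3 : φ.symm (.inl (i + 1 + 1)) = φ.symm (.inl i) := by
      rw [hs (i + 1), hs i, ← h, mul_assoc, genX_mul_self, mul_one]
    have := Sum.inl.inj (φ.symm.injective h3)
    linear_combination this
  have hper : ∀ i, s (i + 1 + 1) = s i := fun i => by
    have key : ∀ a b c : Fin 3, a ≠ 0 → b ≠ 0 → c ≠ 0 → a ≠ b → b ≠ c → c = a := by decide
    exact key _ _ _ (hs0 i) (hs0 (i + 1)) (hs0 _) (hne i) (hne (i + 1))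
  -- The outer labels avoid `a` and change at every step, so they alternate and two steps multiply
  -- by a fixed product.
  have hwalk : ∀ j : ℕ, s ((2 * j : ℕ) : ZMod n) = s 0 ∧
      φ.symm (.inl ((2 * j : ℕ) : ZMod n)) =
        φ.symm (.inl 0) * (genX (3 * m) (s 0) * genX (3 * m) (s (0 + 1))) ^ j := by
    intro j
    induction j with
    | zero => simp
    | succ j ih =>
      have hj : ((2 * (j + 1) : ℕ) : ZMod n) = ((2 * j : ℕ) : ZMod n) + 1 + 1 := by
        push_cast
        ring
      have hs1 : s (((2 * j : ℕ) : ZMod n) + 1) = s (0 + 1) := by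
        have key : ∀ a b c : Fin 3, a ≠ 0 → b ≠ 0 → c ≠ 0 → c ≠ a → c ≠ b → a = b := by decide
        refine key _ _ _ (hs0 _) (hs0 _) (hs0 0) ?_ (hne 0)
        rw [← ih.1]
        exact hne _
      rw [hj, hper, hs (_ + 1), hs ((2 * j : ℕ) : ZMod n), hs1, ih.2, ih.1, pow_succ]
      exact ⟨rfl, by simp only [mul_assoc]⟩
  -- The walk is back at its start after `6m` steps, yet `0 < 6m < 18m = n`.
  have hend := (hwalk (3 * m)).2
  rw [genX_mul_genX_pow m (hs0 0) (hs0 _) (hne 0), mul_one] at hend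
  have := Sum.inl.inj (φ.symm.injective hend)
  exact ZMod.natCast_ne_zero_of_lt (by omega) (by omega) this

theorem mainTheorem8 :
    (∀ m : ℕ, 1 ≤ m →
      Nat.card (Equiv.Perm (Fin 3) × DihedralGroup (3 * m)) = 36 * m ∧
      IsVertexTransitive (graphX (3 * m)) ∧
      IsRainbowDominationRegular (graphX (3 * m)) 3 ∧
      (∀ m' n l : ℕ, 1 ≤ m' → 4 ≤ n → Even n → 2 * l ≤ n → l ≡ m' [MOD 2] →
        IsEmpty (graphX (3 * m) ≃g honeycombToroidal m' n l)) ∧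
      (∀ n k : ℕ, 1 ≤ k → 2 * k ≤ n →
        IsEmpty (graphX (3 * m) ≃g generalizedPetersen n k))) ∧
    (∀ m₁ m₂ : ℕ, 1 ≤ m₁ → 1 ≤ m₂ →
      Nonempty (graphX (3 * m₁) ≃g graphX (3 * m₂)) → m₁ = m₂) := by
  refine ⟨fun m hm => ⟨?_, isVertexTransitive_graphX _,
    isRainbowDominationRegular_graphX (by omega), ?_, ?_⟩, ?_⟩
  · rw [natCard_graphX]
    ring
  · intro m' n l hm' hn hn2 hl hlm
    exact isEmpty_graphX_iso_honeycombToroidal (by omega) hm' hn hn2 hl hlm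
  · intro n k hk hkn
    exact isEmpty_graphX_iso_generalizedPetersen hm (by omega)
  · rintro m₁ m₂ - - ⟨φ⟩
    have h := Nat.card_congr φ.toEquiv
    rw [natCard_graphX, natCard_graphX] at h
    omega
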